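/- Let $\mathcal M$ be a smooth (connected, finite-dimensional) Riemannian manifold with Riemannian metric $\langle\cdot,\cdot\rangle_x$ and Riemannian distance $d$. Let $\mathcal C\subseteq\mathcal M$ be compact, geodesically convex (any two points of $\mathcal C$ are joined by a distance-minimizing geodesic contained in $\mathcal C$) and uniquely geodesic (between any two points of $\mathcal C$ there is exactly one geodesic $[0,1]\to\mathcal M$ contained in $\mathcal C$). For $x,y\in\mathcal C$ let $\operatorname{Exp}_x^{-1}(y)\in T_x\mathcal M$ denote the initial velocity of the geodesic $[0,1]\to\mathcal C$ from $x$ to $y$. Let $f:\mathcal M\to\mathbb R$ be differentiable at every point of $\mathcal C$, with Riemannian gradient $\nabla f$, and suppose that: 1. $f$ is geodesically convex on $\mathcal C$: $f(\gamma(r))\le(1-r)f(x)+r f(y)$ for all $x,y\in\mathcal C$ and $r\in[0,1]$, where $\gamma$ is the geodesic in $\mathcal C$ from $x$ to $y$; 2. $f$ is geodesically $L$-smooth on $\mathcal C$ for some $L>0$: $|f(y)-f(x)-\langle\nabla f(x),\operatorname{Exp}_x^{-1}(y)\rangle_x|\le\frac L2 d(x,y)^2$ for all $x,y\in\mathcal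 C$; 3. there is $c>0$ with $\|\nabla f(x)\|_x>c$ for all $x\in\mathcal C$; 4. $\mathcal C$ satisfies the Riemannian scaling inequality with constant $\alpha>0$: for all $x\in\mathcal C$, $w\in T_x\mathcal M$ and $v\in\operatorname{argmax}_{z\in\mathcal C}\langle w,\operatorname{Exp}_x^{-1}(z)\rangle_x$, $$\langle w,\operatorname{Exp}_x^{-1}(v)\rangle_x\ \ge\ \alpha\,\|w\|_x\,\|\operatorname{Exp}_x^{-1}(v)\|_x^2 .$$ Let $x^*\in\mathcal C$ be a minimizer of $f$ over $\mathcal C$. Let $(x_t)_{t\ge0}$ be produced by Riemannian Frank–Wolfe with short steps: $x_0\in\mathcal C$ and, for every $t\ge0$, $$v_t\in\operatorname*{argmin}_{z\in\mathcal C}\ \langle\nabla f(x_t),\operatorname{Exp}_{x_t}^{-1}(z)\rangle_{x_t},\qquad s_t\in\operatorname*{argmin}_{s\in[0,1]}\Big(s\,\langle\nabla f(x_t),\operatorname{Exp}_{x_t}^{-1}(v_t)\rangle_{x_t}+s^2\,\tfrac L2\,d(x_t,v_t)^2\Big),$$ and $x_{t+1}=\gamma_t(s_t)$, where $\gamma_t$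 is the geodesic in $\mathcal C$ with $\gamma_t(0)=x_t$, $\gamma_t(1)=v_t$. Then, for every $t\ge0$, $$f(x_{t+1})-f(x^*)\ \le\ \max\Big\{\tfrac12,\ 1-\tfrac{\alpha c}{2L}\Big\}\,\big(f(x_t)-f(x^*)\big).$$ -/

import Mathlib

open Set Bundle Manifold
open scoped ContDiff

namespace RiemannianFW

section Geodesics

variable {E : Type*} [NormedAddCommGroup E] [NormedSpace ℝ E]
  {H : Type*} [TopologicalSpace H] (I : ModelWithCorners ℝ E H)
  {M : Type*} [MetricSpace M] [ChartedSpace H M]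
  [RiemannianBundle (fun x : M => TangentSpace I x)]

/-- The metric tensor read in the chart at `x₀`: the coefficient `g_p(u, w)` at the point `p` of the
model space, for constant coordinate vectors `u` and `w`. -/
noncomputable def chartMetric (x₀ : M) (p u w : E) : ℝ :=
  inner ℝ (mfderiv 𝓘(ℝ, E) I (extChartAt I x₀).symm p u)
    (mfderiv 𝓘(ℝ, E) I (extChartAt I x₀).symm p w)

/-- The Christoffel symbols of the first kind of the Levi-Civita connection in the chart at `x₀`,
`g_p(Γ_p(u, v), w) = (D_u g(v, w) + D_v g(u, w) - D_w g(u, v)) / 2`, where `D_a` is the derivative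
at `p` in the direction `a` and `u`, `v`, `w` are constant coordinate vectors. -/
noncomputable def chartChristoffel (x₀ : M) (p u v w : E) : ℝ :=
  (fderiv ℝ (fun q : E => chartMetric I x₀ q v w) p u
    + fderiv ℝ (fun q : E => chartMetric I x₀ q u w) p v
    - fderiv ℝ (fun q : E => chartMetric I x₀ q u v) p w) / 2

/-- `γ`, restricted to `[0, 1]`, is a geodesic: it is smooth, and its covariant acceleration
vanishes. In the chart at `γ t`, where `γ` reads `c`, the vanishing of the covariant acceleration
at time `t` says that `c'' + Γ(c', c') = 0`, that is, `g(c'' + Γ(c', c'), w) = 0` for all `w`.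
Smoothness is required in a neighbourhood of every point of `[0, 1]`, endpoints included; the
values of `γ` away from `[0, 1]` are irrelevant. -/
structure IsGeodesic (γ : ℝ → M) : Prop where
  smooth : ∀ t ∈ Icc (0 : ℝ) 1, ContMDiffAt 𝓘(ℝ, ℝ) I ∞ γ t
  acceleration_eq_zero : ∀ t ∈ Icc (0 : ℝ) 1, ∀ w : E,
    let c : ℝ → E := fun τ => extChartAt I (γ t) (γ τ)
    chartMetric I (γ t) (c t) (deriv (deriv c) t) w
      + chartChristoffel I (γ t) (c t) (deriv c t) (deriv c t) w = 0

/-- `γ` is distance minimizing on `[0, 1]`: its length is the distance between its endpoints. -/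
def IsMinimizing (γ : ℝ → M) : Prop :=
  pathELength I γ 0 1 = edist (γ 0) (γ 1)

/-- `γ` is a geodesic `[0, 1] → M` from `x` to `y` that is contained in `C`. -/
structure IsGeodesicIn (C : Set M) (x y : M) (γ : ℝ → M) : Prop where
  geodesic : IsGeodesic I γ
  source : γ 0 = x
  target : γ 1 = y
  mapsTo : MapsTo γ (Icc (0 : ℝ) 1) C

/-- `C` is geodesically convex: any two of its points are joined by a distance minimizing geodesic
that is contained in `C`. -/
def IsGeodesicallyConvex (C : Set M) : Prop :=
  ∀ x ∈ C, ∀ y ∈ C, ∃ γ : ℝ → M, IsGeodesicIn I C x y γ ∧ IsMinimizing I γ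

/-- `C` is uniquely geodesic: between any two of its points there is exactly one geodesic
`[0, 1] → M` that is contained in `C`. -/
def IsUniquelyGeodesic (C : Set M) : Prop :=
  ∀ x ∈ C, ∀ y ∈ C, ∃ γ : ℝ → M, IsGeodesicIn I C x y γ ∧
    ∀ γ' : ℝ → M, IsGeodesicIn I C x y γ' → EqOn γ' γ (Icc (0 : ℝ) 1)

open Classical in
/-- The inverse exponential map `Exp_x⁻¹ : C → T_x M` of a uniquely geodesic, geodesically convex
set `C`: `Exp_x⁻¹(y)` is the initial velocity of the minimizing geodesic in `C` from `x` to `y`, so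
that this geodesic is `t ↦ Exp_x(t Exp_x⁻¹(y))`, and `Exp_x(Exp_x⁻¹(y)) = y` is its value at `1`.
(If there is no such geodesic the value is `0`.) -/
noncomputable def logMap (C : Set M) (x y : M) : TangentSpace I x :=
  if h : ∃ γ : ℝ → M, IsGeodesicIn I C x y γ ∧ IsMinimizing I γ then
    (mfderiv 𝓘(ℝ, ℝ) I h.choose 0 (1 : ℝ) : E)
  else 0

/-- `f` is geodesically convex on `C`: it is convex along the geodesics contained in `C`. -/
def GeodesicallyConvexOn (C : Set M) (f : M → ℝ) : Prop :=
  ∀ x ∈ C, ∀ y ∈ C, ∀ γ : ℝ → M, IsGeodesicIn I C x y γ →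
    ∀ t ∈ Icc (0 : ℝ) 1, f (γ t) ≤ (1 - t) * f x + t * f y

/-- The Riemannian scaling inequality on `C` with constant `α`: for every `x ∈ C`, `w ∈ T_x M` and
every maximizer `v` of `z ↦ ⟨w, Exp_x⁻¹(z)⟩` over `z ∈ C`,
`⟨w, Exp_x⁻¹(v)⟩ ≥ α ‖w‖ ‖Exp_x⁻¹(v)‖²`. -/
def ScalingInequality (C : Set M) (α : ℝ) : Prop :=
  ∀ x ∈ C, ∀ w : TangentSpace I x, ∀ v ∈ C,
    IsMaxOn (fun z => inner ℝ w (logMap I C x z)) C v →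
      α * ‖w‖ * ‖logMap I C x v‖ ^ 2 ≤ inner ℝ w (logMap I C x v)

end Geodesics

section Gradient

variable {E : Type*} [NormedAddCommGroup E] [NormedSpace ℝ E] [FiniteDimensional ℝ E]
  {H : Type*} [TopologicalSpace H] (I : ModelWithCorners ℝ E H)
  {M : Type*} [MetricSpace M] [ChartedSpace H M]
  [RiemannianBundle (fun x : M => TangentSpace I x)]

instance finiteDimensional_tangentSpace (x : M) : FiniteDimensional ℝ (TangentSpace I x) :=
  inferInstanceAs (FiniteDimensional ℝ E)

instance completeSpace_tangentSpace (x : M) : CompleteSpace (TangentSpace I x) :=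
  FiniteDimensional.complete ℝ (TangentSpace I x)

/-- The Riemannian gradient: the vector of `T_x M` that represents the differential of `f` at `x`
(meaningful where `f` is differentiable). -/
noncomputable def riemGradient (f : M → ℝ) (x : M) : TangentSpace I x :=
  (InnerProductSpace.toDual ℝ (TangentSpace I x)).symm
    (mfderiv I 𝓘(ℝ, ℝ) f x : TangentSpace I x →L[ℝ] ℝ)

/-- The defining property of the Riemannian gradient, `Df(x)[v] = ⟨v, ∇f(x)⟩`. -/
theorem inner_riemGradient (f : M → ℝ) (x : M) (v : TangentSpace I x) :
    inner ℝ v (riemGradient I f x) = (mfderiv I 𝓘(ℝ, ℝ) f x v : ℝ) := by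
  rw [real_inner_comm]
  exact InnerProductSpace.toDual_symm_apply (𝕜 := ℝ) (E := TangentSpace I x)
    (y := (mfderiv I 𝓘(ℝ, ℝ) f x : TangentSpace I x →L[ℝ] ℝ))

/-- `f` is geodesically `L`-smooth on `C`:
`|f(y) - f(x) - ⟨∇f(x), Exp_x⁻¹(y)⟩| ≤ (L / 2) d(x, y)²` for all `x, y ∈ C`. -/
def GeodesicallySmoothOn (C : Set M) (L : ℝ) (f : M → ℝ) : Prop :=
  ∀ x ∈ C, ∀ y ∈ C,
    |f y - f x - inner ℝ (riemGradient I f x) (logMap I C x y)| ≤ L / 2 * dist x y ^ 2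

/-- `x`, `v`, `s` are the iterates, the Frank-Wolfe vertices and the step sizes of a run of
Riemannian Frank-Wolfe with short steps on `C`, for the objective `f` with smoothness constant
`L`. -/
structure IsRFWRun (C : Set M) (f : M → ℝ) (L : ℝ) (x v : ℕ → M) (s : ℕ → ℝ) : Prop where
  init_mem : x 0 ∈ C
  vertex_mem : ∀ t, v t ∈ C
  vertex_isMinOn : ∀ t,
    IsMinOn (fun z => inner ℝ (riemGradient I f (x t)) (logMap I C (x t) z)) C (v t)
  step_mem : ∀ t, s t ∈ Icc (0 : ℝ) 1
  step_isMinOn : ∀ t,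
    IsMinOn (fun r : ℝ => r * inner ℝ (riemGradient I f (x t)) (logMap I C (x t) (v t))
      + r ^ 2 * (L / 2) * dist (x t) (v t) ^ 2) (Icc (0 : ℝ) 1) (s t)
  next_eq : ∀ t, ∃ γ : ℝ → M, IsGeodesicIn I C (x t) (v t) γ ∧ x (t + 1) = γ (s t)

end Gradient

end RiemannianFW

namespace RiemannianFW

section BilinForm

variable {E : Type*} [NormedAddCommGroup E] [NormedSpace ℝ E]

set_option synthInstance.maxHeartbeats 200000 in
set_option maxHeartbeats 800000 in
/-- The derivative of `g(c', c')` along a curve `c`, for a field `g` of symmetric bilinear forms. -/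
theorem hasDerivAt_bilinForm_deriv {g : E → E →L[ℝ] E →L[ℝ] ℝ} {c : ℝ → E} {t : ℝ}
    (hg : DifferentiableAt ℝ g (c t)) (hc : ContDiffAt ℝ ∞ c t)
    (hsymm : ∀ u w, g (c t) u w = g (c t) w u) :
    HasDerivAt (fun τ => g (c τ) (deriv c τ) (deriv c τ))
      (2 * g (c t) (deriv (deriv c) t) (deriv c t)
        + fderiv ℝ (fun q => g q (deriv c t) (deriv c t)) (c t) (deriv c t)) t := by
  have hc1 : HasDerivAt c (deriv c t) t := (hc.differentiableAt (by simp)).hasDerivAt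
  have hc2 : HasDerivAt (deriv c) (deriv (deriv c) t) t := by
    have h := (hc.fderiv_right (m := ∞) (by simp)).differentiableAt (by simp)
    exact (h.clm_apply (differentiableAt_const (1 : ℝ))).hasDerivAt
  have hg' : HasFDerivAt g (fderiv ℝ g (c t)) (c t) := hg.hasFDerivAt
  have hconst : HasFDerivAt (fun q => g q (deriv c t) (deriv c t)) _ (c t) :=
    (hg'.clm_apply (hasFDerivAt_const (deriv c t) (c t))).clm_apply
      (hasFDerivAt_const (deriv c t) (c t))
  have hgc : HasDerivAt (fun τ => g (c τ)) (fderiv ℝ g (c t) (deriv c t)) t :=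
    HasFDerivAt.comp_hasDerivAt (l := g) (f := c) t hg' hc1
  have h := (hgc.clm_apply hc2).clm_apply hc2
  refine h.congr_deriv ?_
  rw [hconst.fderiv]
  simp [hsymm (deriv c t)]
  ring

end BilinForm

section MetricInChart

variable {E : Type*} [NormedAddCommGroup E] [NormedSpace ℝ E]
  {H : Type*} [TopologicalSpace H] (I : ModelWithCorners ℝ E H)
  {M : Type*} [MetricSpace M] [ChartedSpace H M]
  [RiemannianBundle (fun x : M => TangentSpace I x)]

/-- The coefficients of the metric in the chart at `x₀`, as a continuous bilinear form. -/
noncomputable def chartMetricForm (x₀ : M) (p : E) : E →L[ℝ] E →L[ℝ] ℝ :=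
  let A : E →L[ℝ] TangentSpace I ((extChartAt I x₀).symm p) :=
    mfderiv 𝓘(ℝ, E) I (extChartAt I x₀).symm p
  (innerSL ℝ).bilinearComp A A

theorem chartMetricForm_apply (x₀ : M) (p u w : E) :
    chartMetricForm I x₀ p u w = chartMetric I x₀ p u w := rfl

theorem chartMetric_comm (x₀ : M) (p u w : E) :
    chartMetric I x₀ p u w = chartMetric I x₀ p w u :=
  real_inner_comm _ _

theorem chartMetric_smul_left (x₀ : M) (p u w : E) (a : ℝ) :
    chartMetric I x₀ p (a • u) w = a * chartMetric I x₀ p u w := by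
  simp [← chartMetricForm_apply]

theorem chartMetric_smul_right (x₀ : M) (p u w : E) (a : ℝ) :
    chartMetric I x₀ p u (a • w) = a * chartMetric I x₀ p u w := by
  simp [← chartMetricForm_apply]

theorem chartChristoffel_smul_smul (x₀ : M) (p u w : E) (a : ℝ) :
    chartChristoffel I x₀ p (a • u) (a • u) w = a ^ 2 * chartChristoffel I x₀ p u u w := by
  have key (g : E → ℝ) (b : ℝ) : fderiv ℝ (fun q => b * g q) p = b • fderiv ℝ g p :=
    congrFun (fderiv_const_smul_field b) p
  simp only [chartChristoffel, chartMetric_smul_left, chartMetric_smul_right, key, map_smul,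
    smul_eq_mul, FunLike.coe_smul, Pi.smul_apply]
  ring

variable [I.Boundaryless] [IsManifold I ∞ M]
    [IsContMDiffRiemannianBundle I ∞ E (fun x : M => TangentSpace I x)]

theorem contDiffOn_chartMetric (x₀ : M) (u w : E) :
    ContDiffOn ℝ ∞ (fun q => chartMetric I x₀ q u w) (extChartAt I x₀).target := by
  have hsec (u : E) : ContMDiffOn 𝓘(ℝ, E) I.tangent ∞
      (fun q : E => (⟨(extChartAt I x₀).symm q,
        mfderiv 𝓘(ℝ, E) I (extChartAt I x₀).symm q u⟩ : TangentBundle I M))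
      (extChartAt I x₀).target := by
    have h1 := (contMDiffOn_extChartAt_symm (I := I) (n := ∞) x₀).contMDiffOn_tangentMapWithin
      (m := ∞) (by simp) (isOpen_extChartAt_target x₀).uniqueMDiffOn
    have h2 : ContMDiffOn 𝓘(ℝ, E) 𝓘(ℝ, E).tangent ∞
        (fun q : E => (⟨q, u⟩ : TangentBundle 𝓘(ℝ, E) E)) (extChartAt I x₀).target := by
      intro q hq
      exact contMDiffWithinAt_vectorSpace_iff_contDiffWithinAt.2 contDiffWithinAt_const
    refine (h1.comp h2 (fun q hq => hq)).congr fun q hq => ?_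
    simp only [Function.comp, tangentMapWithin]
    rw [mfderivWithin_of_isOpen (isOpen_extChartAt_target x₀) hq]
  exact contMDiffOn_iff_contDiffOn.1 <|
    ContMDiffOn.inner_bundle (F := E) (E := fun x : M => TangentSpace I x)
      (b := (extChartAt I x₀).symm)
      (v := fun q => mfderiv 𝓘(ℝ, E) I (extChartAt I x₀).symm q u)
      (w := fun q => mfderiv 𝓘(ℝ, E) I (extChartAt I x₀).symm q w) (hsec u) (hsec w)

variable [FiniteDimensional ℝ E]

theorem contDiffOn_chartMetricForm (x₀ : M) :
    ContDiffOn ℝ ∞ (chartMetricForm I x₀) (extChartAt I x₀).target :=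
  contDiffOn_clm_apply.2 fun u => contDiffOn_clm_apply.2 fun w => contDiffOn_chartMetric I x₀ u w

theorem hasDerivAt_chartMetric_deriv (x₀ : M) {c : ℝ → E} {t : ℝ}
    (hp : c t ∈ (extChartAt I x₀).target) (hc : ContDiffAt ℝ ∞ c t) :
    HasDerivAt (fun τ => chartMetric I x₀ (c τ) (deriv c τ) (deriv c τ))
      (2 * (chartMetric I x₀ (c t) (deriv (deriv c) t) (deriv c t)
        + chartChristoffel I x₀ (c t) (deriv c t) (deriv c t) (deriv c t))) t := by
  have hG := ((contDiffOn_chartMetricForm I x₀).contDiffAt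
    (extChartAt_target_mem_nhds' hp)).differentiableAt (by simp)
  refine (hasDerivAt_bilinForm_deriv hG hc (chartMetric_comm I x₀ (c t))).congr_deriv ?_
  simp only [chartChristoffel, chartMetricForm_apply]
  ring

end MetricInChart

section Speed

open Filter Topology

variable {E : Type*} [NormedAddCommGroup E] [NormedSpace ℝ E]
  {H : Type*} [TopologicalSpace H] {I : ModelWithCorners ℝ E H}
  {M : Type*} [MetricSpace M] [ChartedSpace H M]
  [RiemannianBundle (fun x : M => TangentSpace I x)]

theorem norm_mfderiv_congr {γ δ : ℝ → M} {t : ℝ} (h : γ =ᶠ[𝓝 t] δ) :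
    ‖mfderiv 𝓘(ℝ, ℝ) I γ t (1 : ℝ)‖ = ‖mfderiv 𝓘(ℝ, ℝ) I δ t (1 : ℝ)‖ := by
  have key {p q : M} (hpq : p = q) (u : TangentSpace I p) (w : TangentSpace I q)
      (huw : (u : E) = w) : ‖u‖ = ‖w‖ := by
    subst hpq
    exact congrArg (fun z : TangentSpace I p => ‖z‖) huw
  exact key h.eq_of_nhds _ _
    (congrArg (fun A : ℝ →L[ℝ] E => A 1) (h.mfderiv_eq (I := 𝓘(ℝ, ℝ)) (I' := I)))

variable [I.Boundaryless] [IsManifold I ∞ M]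

theorem norm_mfderiv_sq_eq_chartMetric (x₀ : M) {γ : ℝ → M} {t : ℝ}
    (hγ : MDifferentiableAt 𝓘(ℝ, ℝ) I γ t) (ht : γ t ∈ (extChartAt I x₀).source) :
    ‖mfderiv 𝓘(ℝ, ℝ) I γ t (1 : ℝ)‖ ^ 2
      = chartMetric I x₀ (extChartAt I x₀ (γ t)) (deriv (fun τ => extChartAt I x₀ (γ τ)) t)
          (deriv (fun τ => extChartAt I x₀ (γ τ)) t) := by
  set c : ℝ → E := fun τ => extChartAt I x₀ (γ τ) with hc
  have hcd : MDifferentiableAt 𝓘(ℝ, ℝ) 𝓘(ℝ, E) c t :=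
    (mdifferentiableAt_extChartAt (by simpa using ht)).comp t hγ
  have hσ : MDifferentiableAt 𝓘(ℝ, E) I (extChartAt I x₀).symm (c t) :=
    (mdifferentiableOn_extChartAt_symm (c t) ((extChartAt I x₀).map_source ht)).mdifferentiableAt
      (extChartAt_target_mem_nhds' ((extChartAt I x₀).map_source ht))
  have hev : γ =ᶠ[𝓝 t] (extChartAt I x₀).symm ∘ c := by
    filter_upwards [hγ.continuousAt.preimage_mem_nhds
      ((isOpen_extChartAt_source x₀).mem_nhds ht)] with τ hτ
    exact ((extChartAt I x₀).left_inv hτ).symm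
  have e : (mfderiv 𝓘(ℝ, ℝ) I ((extChartAt I x₀).symm ∘ c) t (1 : ℝ) : E)
      = mfderiv 𝓘(ℝ, E) I (extChartAt I x₀).symm (c t) (deriv c t) :=
    (mfderiv_comp_apply t hσ hcd (1 : ℝ)).trans <|
      congrArg (mfderiv 𝓘(ℝ, E) I (extChartAt I x₀).symm (c t))
        (congrArg (fun A : ℝ →L[ℝ] E => A 1) mfderiv_eq_fderiv)
  refine (congrArg (· ^ 2) (norm_mfderiv_congr hev)).trans ?_
  refine (real_inner_self_eq_norm_sq _).symm.trans ?_
  exact congrArg (fun w : TangentSpace I ((extChartAt I x₀).symm (c t)) => inner ℝ w w) e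

variable [IsContMDiffRiemannianBundle I ∞ E (fun x : M => TangentSpace I x)]
  [FiniteDimensional ℝ E]

theorem IsGeodesic.hasDerivAt_norm_sq {γ : ℝ → M} (hγ : IsGeodesic I γ) {t : ℝ}
    (ht : t ∈ Icc (0 : ℝ) 1) :
    HasDerivAt (fun τ => ‖mfderiv 𝓘(ℝ, ℝ) I γ τ (1 : ℝ)‖ ^ 2) 0 t := by
  have hs := hγ.smooth t ht
  have hc : ContDiffAt ℝ ∞ (fun τ => extChartAt I (γ t) (γ τ)) t :=
    ((contMDiffAt_extChartAt (I := I) (n := ∞) (x := γ t)).comp t hs).contDiffAt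
  have h := hasDerivAt_chartMetric_deriv I (γ t) (mem_extChartAt_target (γ t)) hc
  have h0 := hγ.acceleration_eq_zero t ht (deriv (fun τ => extChartAt I (γ t) (γ τ)) t)
  rw [h0, mul_zero] at h
  refine h.congr_of_eventuallyEq ?_
  have h1 : ∀ᶠ τ in 𝓝 t, ContMDiffAt 𝓘(ℝ, ℝ) I 1 γ τ :=
    (contMDiffAt_iff_contMDiffAt_nhds (by simp)).1 (hs.of_le (by simp))
  filter_upwards [h1, hs.continuousAt.preimage_mem_nhds
      ((isOpen_extChartAt_source (I := I) (γ t)).mem_nhds (mem_extChartAt_source (γ t)))]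
    with τ hτ hτ'
  exact norm_mfderiv_sq_eq_chartMetric (γ t) (hτ.mdifferentiableAt (by simp)) hτ'

/-- Geodesics have constant speed. -/
theorem IsGeodesic.norm_mfderiv_eq {γ : ℝ → M} (hγ : IsGeodesic I γ) {t : ℝ}
    (ht : t ∈ Icc (0 : ℝ) 1) :
    ‖mfderiv 𝓘(ℝ, ℝ) I γ t (1 : ℝ)‖ = ‖mfderiv 𝓘(ℝ, ℝ) I γ 0 (1 : ℝ)‖ := by
  have h := constant_of_has_deriv_right_zero
    (fun τ hτ => (hγ.hasDerivAt_norm_sq hτ).continuousAt.continuousWithinAt)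
    (fun τ hτ => (hγ.hasDerivAt_norm_sq (Ico_subset_Icc_self hτ)).hasDerivWithinAt) t ht
  exact (sq_eq_sq₀ (norm_nonneg _) (norm_nonneg _)).1 h

theorem IsGeodesic.pathELength_eq {γ : ℝ → M} (hγ : IsGeodesic I γ) {s : ℝ}
    (hs : s ∈ Icc (0 : ℝ) 1) :
    pathELength I γ 0 s = ENNReal.ofReal (s * ‖mfderiv 𝓘(ℝ, ℝ) I γ 0 (1 : ℝ)‖) := by
  rw [pathELength_eq_lintegral_mfderiv_Icc,
    MeasureTheory.setLIntegral_congr_fun (g := fun _ => ENNReal.ofReal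
      ‖mfderiv 𝓘(ℝ, ℝ) I γ 0 (1 : ℝ)‖) measurableSet_Icc fun t ht => ?_]
  · simp [ENNReal.ofReal_mul hs.1, mul_comm]
  · rw [← ofReal_norm]
    exact congrArg ENNReal.ofReal (hγ.norm_mfderiv_eq ⟨ht.1, ht.2.trans hs.2⟩)

theorem IsGeodesic.dist_eq {γ : ℝ → M} (hγ : IsGeodesic I γ) (hmin : IsMinimizing I γ) :
    dist (γ 0) (γ 1) = ‖mfderiv 𝓘(ℝ, ℝ) I γ 0 (1 : ℝ)‖ := by
  have h := hmin
  rw [IsMinimizing, hγ.pathELength_eq (right_mem_Icc.2 zero_le_one), one_mul, edist_dist] at h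
  exact ((ENNReal.ofReal_eq_ofReal_iff (norm_nonneg _) dist_nonneg).1 h).symm

theorem IsGeodesic.dist_le [IsRiemannianManifold I M] {γ : ℝ → M} (hγ : IsGeodesic I γ) {s : ℝ}
    (hs : s ∈ Icc (0 : ℝ) 1) :
    dist (γ 0) (γ s) ≤ s * ‖mfderiv 𝓘(ℝ, ℝ) I γ 0 (1 : ℝ)‖ := by
  have h : riemannianEDist I (γ 0) (γ s) ≤ pathELength I γ 0 s :=
    riemannianEDist_le_pathELength (fun t ht =>
      ((hγ.smooth t ⟨ht.1, ht.2.trans hs.2⟩).of_le (by simp)).contMDiffWithinAt) rfl rfl hs.1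
  rw [← IsRiemannianManifold.out (I := I), hγ.pathELength_eq hs, edist_dist] at h
  exact (ENNReal.ofReal_le_ofReal_iff (mul_nonneg hs.1 (norm_nonneg _))).1 h

end Speed

section LogMap

variable {E : Type*} [NormedAddCommGroup E] [NormedSpace ℝ E]
  {H : Type*} [TopologicalSpace H] {I : ModelWithCorners ℝ E H}
  {M : Type*} [MetricSpace M] [ChartedSpace H M]

theorem mfderiv_comp_const_mul {γ : ℝ → M} {s t : ℝ}
    (hγ : MDifferentiableAt 𝓘(ℝ, ℝ) I γ (s * t)) :
    (mfderiv 𝓘(ℝ, ℝ) I (fun τ => γ (s * τ)) t (1 : ℝ) : E)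
      = s • (mfderiv 𝓘(ℝ, ℝ) I γ (s * t) (1 : ℝ) : E) := by
  have hm : HasDerivAt (fun τ : ℝ => s * τ) s t := by
    simpa using (hasDerivAt_id t).const_mul s
  have h := mfderiv_comp_apply (I := 𝓘(ℝ, ℝ)) (I' := 𝓘(ℝ, ℝ)) (I'' := I) (g := γ)
    (f := fun τ : ℝ => s * τ) t hγ hm.differentiableAt.mdifferentiableAt (1 : ℝ)
  refine h.trans ?_
  rw [mfderiv_eq_fderiv, hm.hasFDerivAt.fderiv]
  have e : (ContinuousLinearMap.toSpanSingleton ℝ s : ℝ →L[ℝ] ℝ) 1 = s • (1 : ℝ) := by simp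
  refine (congrArg (mfderiv 𝓘(ℝ, ℝ) I γ (s * t)) e).trans ?_
  exact map_smul (mfderiv 𝓘(ℝ, ℝ) I γ (s * t)) s (1 : ℝ)

theorem mfderiv_eq_of_eqOn {γ δ : ℝ → M} (hγ : MDifferentiableAt 𝓘(ℝ, ℝ) I γ 0)
    (hδ : MDifferentiableAt 𝓘(ℝ, ℝ) I δ 0) (h : EqOn γ δ (Icc (0 : ℝ) 1)) :
    (mfderiv 𝓘(ℝ, ℝ) I γ 0 (1 : ℝ) : E) = mfderiv 𝓘(ℝ, ℝ) I δ 0 (1 : ℝ) := by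
  have h0 : (0 : ℝ) ∈ Icc (0 : ℝ) 1 := left_mem_Icc.2 zero_le_one
  have hu : UniqueMDiffWithinAt 𝓘(ℝ, ℝ) (Icc (0 : ℝ) 1) 0 :=
    (uniqueDiffOn_Icc_zero_one 0 h0).uniqueMDiffWithinAt
  have e : mfderivWithin 𝓘(ℝ, ℝ) I γ (Icc (0 : ℝ) 1) 0
      = mfderivWithin 𝓘(ℝ, ℝ) I δ (Icc (0 : ℝ) 1) 0 := mfderivWithin_congr h (h h0)
  rw [mfderivWithin_eq_mfderiv hu hγ, mfderivWithin_eq_mfderiv hu hδ] at e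
  exact congrArg (fun A : ℝ →L[ℝ] E => A 1) e

variable [RiemannianBundle (fun x : M => TangentSpace I x)]

theorem IsGeodesicIn.restrict {C : Set M} {x y : M} {γ : ℝ → M} (hγ : IsGeodesicIn I C x y γ)
    {s : ℝ} (hs : s ∈ Icc (0 : ℝ) 1) :
    IsGeodesicIn I C x (γ s) (fun τ => γ (s * τ)) := by
  have hmem {t : ℝ} (ht : t ∈ Icc (0 : ℝ) 1) : s * t ∈ Icc (0 : ℝ) 1 :=
    ⟨mul_nonneg hs.1 ht.1, mul_le_one₀ hs.2 ht.1 ht.2⟩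
  refine ⟨⟨fun t ht => ?_, fun t ht w => ?_⟩, by simpa using hγ.source, by simp,
    fun t ht => hγ.mapsTo (hmem ht)⟩
  · have hm : ContMDiffAt 𝓘(ℝ, ℝ) 𝓘(ℝ, ℝ) ∞ (fun τ : ℝ => s * τ) t :=
      (contDiff_const.mul contDiff_id).contMDiff.contMDiffAt
    exact ContMDiffAt.comp t (hγ.geodesic.smooth _ (hmem ht)) hm
  · intro c
    have h := hγ.geodesic.acceleration_eq_zero _ (hmem ht) w
    set c₁ : ℝ → E := fun τ => extChartAt I (γ (s * t)) (γ τ) with hc₁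
    have hc : c = fun τ => c₁ (s * τ) := rfl
    have h1 : deriv c = fun τ => s • deriv c₁ (s * τ) := by
      ext τ
      rw [hc, deriv_comp_mul_left]
    have h2 : deriv (deriv c) t = s ^ 2 • deriv (deriv c₁) (s * t) := by
      rw [h1, deriv_fun_const_smul_field, deriv_comp_mul_left, smul_smul, sq]
    rw [h2, h1, chartMetric_smul_left, chartChristoffel_smul_smul, ← mul_add]
    exact mul_eq_zero_of_right _ h

theorem exists_logMap_eq {C : Set M} (hC : IsGeodesicallyConvex I C) {x y : M} (hx : x ∈ C)
    (hy : y ∈ C) : ∃ γ : ℝ → M, IsGeodesicIn I C x y γ ∧ IsMinimizing I γ ∧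
      (logMap I C x y : E) = mfderiv 𝓘(ℝ, ℝ) I γ 0 (1 : ℝ) := by
  have h := hC x hx y hy
  refine ⟨h.choose, h.choose_spec.1, h.choose_spec.2, ?_⟩
  exact dif_pos h

theorem IsGeodesicIn.mdifferentiableAt {C : Set M} {x y : M} {γ : ℝ → M}
    (hγ : IsGeodesicIn I C x y γ) : MDifferentiableAt 𝓘(ℝ, ℝ) I γ 0 :=
  (hγ.geodesic.smooth 0 (left_mem_Icc.2 zero_le_one)).mdifferentiableAt (by simp)

theorem IsUniquelyGeodesic.eqOn {C : Set M} (hC : IsUniquelyGeodesic I C) {x y : M} (hx : x ∈ C)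
    (hy : y ∈ C) {γ δ : ℝ → M} (hγ : IsGeodesicIn I C x y γ) (hδ : IsGeodesicIn I C x y δ) :
    EqOn γ δ (Icc (0 : ℝ) 1) := by
  obtain ⟨η, -, hη⟩ := hC x hx y hy
  exact (hη γ hγ).trans (hη δ hδ).symm

/-- `Exp_x⁻¹(y)` is the initial velocity of the geodesic in `C` from `x` to `y`. -/
theorem IsGeodesicIn.logMap_eq {C : Set M} (hC : IsGeodesicallyConvex I C)
    (hU : IsUniquelyGeodesic I C) {x y : M} (hx : x ∈ C) (hy : y ∈ C) {γ : ℝ → M}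
    (hγ : IsGeodesicIn I C x y γ) :
    (logMap I C x y : E) = mfderiv 𝓘(ℝ, ℝ) I γ 0 (1 : ℝ) := by
  obtain ⟨δ, hδ, -, h⟩ := exists_logMap_eq hC hx hy
  exact h.trans (mfderiv_eq_of_eqOn hδ.mdifferentiableAt hγ.mdifferentiableAt
    (hU.eqOn hx hy hδ hγ))

/-- `Exp_x⁻¹(γ(s)) = s Exp_x⁻¹(y)` along the geodesic `γ` in `C` from `x` to `y`. -/
theorem IsGeodesicIn.logMap_apply {C : Set M} (hC : IsGeodesicallyConvex I C)
    (hU : IsUniquelyGeodesic I C) {x y : M} (hx : x ∈ C) (hy : y ∈ C) {γ : ℝ → M}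
    (hγ : IsGeodesicIn I C x y γ) {s : ℝ} (hs : s ∈ Icc (0 : ℝ) 1) :
    logMap I C x (γ s) = s • logMap I C x y := by
  have h1 := (hγ.restrict hs).logMap_eq hC hU hx (hγ.mapsTo hs)
  have h2 := hγ.logMap_eq hC hU hx hy
  have h3 := mfderiv_comp_const_mul (I := I) (γ := γ) (s := s) (t := 0)
    (by simpa using hγ.mdifferentiableAt)
  rw [mul_zero] at h3
  refine h1.trans (h3.trans ?_)
  exact congrArg (fun w : E => s • w) h2.symm

/-- The first-order characterization of geodesic convexity. -/
theorem GeodesicallyConvexOn.inner_le {C : Set M} [FiniteDimensional ℝ E]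
    (hC : IsGeodesicallyConvex I C) {f : M → ℝ}
    (hf : GeodesicallyConvexOn I C f) {x y : M} (hx : x ∈ C) (hy : y ∈ C)
    (hd : MDifferentiableAt I 𝓘(ℝ, ℝ) f x) :
    inner ℝ (riemGradient I f x) (logMap I C x y) ≤ f y - f x := by
  obtain ⟨γ, hγ, -, h⟩ := exists_logMap_eq hC hx hy
  have hle := hf x hx y hy γ hγ
  rw [real_inner_comm, inner_riemGradient]
  obtain rfl := hγ.source
  have hmd : MDifferentiableAt 𝓘(ℝ, ℝ) 𝓘(ℝ, ℝ) (f ∘ γ) 0 := hd.comp 0 hγ.mdifferentiableAt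
  have hderiv : HasDerivAt (f ∘ γ) (mfderiv I 𝓘(ℝ, ℝ) f (γ 0) (logMap I C (γ 0) y)) 0 := by
    refine hmd.differentiableAt.hasDerivAt.congr_deriv ?_
    have h2 := mfderiv_comp_apply 0 hd hγ.mdifferentiableAt (1 : ℝ)
    rw [mfderiv_eq_fderiv] at h2
    exact (show deriv (f ∘ γ) 0 = _ from h2).trans
      (congrArg (mfderiv I 𝓘(ℝ, ℝ) f (γ 0)) h.symm)
  refine le_of_tendsto hderiv.tendsto_slope_zero_right ?_
  filter_upwards [Ioc_mem_nhdsGT (zero_lt_one' ℝ)] with t ht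
  have := hle t ⟨ht.1.le, ht.2⟩
  rw [zero_add, smul_eq_mul, inv_mul_le_iff₀ ht.1]
  simp only [Function.comp_apply]
  linarith

variable [I.Boundaryless] [IsManifold I ∞ M]
  [IsContMDiffRiemannianBundle I ∞ E (fun x : M => TangentSpace I x)] [FiniteDimensional ℝ E]

theorem norm_logMap {C : Set M} (hC : IsGeodesicallyConvex I C) {x y : M} (hx : x ∈ C)
    (hy : y ∈ C) : ‖logMap I C x y‖ = dist x y := by
  obtain ⟨γ, hγ, hmin, h⟩ := exists_logMap_eq hC hx hy
  obtain rfl := hγ.source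
  obtain rfl := hγ.target
  rw [hγ.geodesic.dist_eq hmin]
  exact congrArg (fun w : TangentSpace I (γ 0) => ‖w‖) h

theorem IsGeodesicIn.dist_le [IsRiemannianManifold I M] {C : Set M}
    (hC : IsGeodesicallyConvex I C) (hU : IsUniquelyGeodesic I C) {x y : M} (hx : x ∈ C)
    (hy : y ∈ C) {γ : ℝ → M} (hγ : IsGeodesicIn I C x y γ) {s : ℝ} (hs : s ∈ Icc (0 : ℝ) 1) :
    dist x (γ s) ≤ s * dist x y := by
  have h := hγ.logMap_eq hC hU hx hy
  have h' := hγ.geodesic.dist_le hs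
  rw [← norm_logMap hC hx hy]
  obtain rfl := hγ.source
  exact h'.trans_eq (congrArg (fun w : TangentSpace I (γ 0) => s * ‖w‖) h.symm)

end LogMap

/-- A short step decreases the quadratic upper model by a fixed fraction of the gap. -/
theorem shortStep_contraction {h h' g D L κ r : ℝ} (hL : 0 < L) (hκ : 0 ≤ κ) (hh : 0 ≤ h)
    (hg : h ≤ -g) (hscal : κ * D ≤ -g)
    (hstep : h' ≤ h + (r * g + r ^ 2 * (L / 2) * D))
    (hr : IsMinOn (fun r : ℝ => r * g + r ^ 2 * (L / 2) * D) (Icc (0 : ℝ) 1) r) :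
    h' ≤ h * max (1 / 2) (1 - κ / (2 * L)) := by
  have hmodel {q : ℝ} (hq : q ∈ Icc (0 : ℝ) 1) : h' ≤ h + (q * g + q ^ 2 * (L / 2) * D) :=
    hstep.trans (by have := isMinOn_iff.1 hr q hq; linarith)
  rcases le_or_gt (L * D) (-g) with hcase | hcase
  · calc h' ≤ h * (1 / 2) := by
          have := hmodel (right_mem_Icc.2 zero_le_one)
          linarith
      _ ≤ _ := mul_le_mul_of_nonneg_left (le_max_left _ _) hh
  · have hLD : 0 < L * D := by linarith
    have hDpos : 0 < D := pos_of_mul_pos_right hLD hL.le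
    have hq := hmodel (q := -g / (L * D))
      ⟨div_nonneg (by linarith) hLD.le, (div_le_one hLD).2 hcase.le⟩
    have e : -g / (L * D) * g + (-g / (L * D)) ^ 2 * (L / 2) * D
        = -((-g) * (-g / D) / (2 * L)) := by
      field_simp
      ring
    have hκ' : κ ≤ -g / D := (le_div_iff₀ hDpos).2 hscal
    have hprod : h * κ ≤ -g * (-g / D) := mul_le_mul hg hκ' hκ (by linarith)
    calc h' ≤ h * (1 - κ / (2 * L)) := by
          have := div_le_div_of_nonneg_right hprod (by linarith : 0 ≤ 2 * L)
          rw [e] at hq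
          rw [mul_sub, mul_one, ← mul_div_assoc]
          linarith
      _ ≤ _ := mul_le_mul_of_nonneg_left (le_max_right _ _) hh

theorem IsRFWRun.mem {E : Type*} [NormedAddCommGroup E] [NormedSpace ℝ E] [FiniteDimensional ℝ E]
    {H : Type*} [TopologicalSpace H] {I : ModelWithCorners ℝ E H}
    {M : Type*} [MetricSpace M] [ChartedSpace H M]
    [RiemannianBundle (fun x : M => TangentSpace I x)] {C : Set M} {f : M → ℝ} {L : ℝ}
    {x v : ℕ → M} {s : ℕ → ℝ} (h : IsRFWRun I C f L x v s) : ∀ t, x t ∈ C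
  | 0 => h.init_mem
  | t + 1 => by
    obtain ⟨γ, hγ, e⟩ := h.next_eq t
    exact e ▸ hγ.mapsTo (h.step_mem t)

end RiemannianFW

theorem mainTheorem1
    {E : Type*} [NormedAddCommGroup E] [NormedSpace ℝ E] [FiniteDimensional ℝ E]
    {H : Type*} [TopologicalSpace H] (I : ModelWithCorners ℝ E H) [I.Boundaryless]
    {M : Type*} [MetricSpace M] [ChartedSpace H M] [IsManifold I ∞ M]
    [RiemannianBundle (fun x : M => TangentSpace I x)]
    [IsContMDiffRiemannianBundle I ∞ E (fun x : M => TangentSpace I x)]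
    [IsRiemannianManifold I M]
    (C : Set M) (hCcompact : IsCompact C)
    (hCconvex : RiemannianFW.IsGeodesicallyConvex I C)
    (hCunique : RiemannianFW.IsUniquelyGeodesic I C)
    (f : M → ℝ) (hfdiff : ∀ x ∈ C, MDifferentiableAt I 𝓘(ℝ, ℝ) f x)
    (hfconvex : RiemannianFW.GeodesicallyConvexOn I C f)
    (L : ℝ) (hL : 0 < L) (hfsmooth : RiemannianFW.GeodesicallySmoothOn I C L f)
    (c : ℝ) (hc : 0 < c) (hgrad : ∀ x ∈ C, c < ‖RiemannianFW.riemGradient I f x‖)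
    (α : ℝ) (hα : 0 < α) (hscaling : RiemannianFW.ScalingInequality I C α)
    (xstar : M) (hxstar : xstar ∈ C) (hmin : IsMinOn f C xstar)
    (x v : ℕ → M) (s : ℕ → ℝ) (hrun : RiemannianFW.IsRFWRun I C f L x v s) (t : ℕ) :
    f (x (t + 1)) - f xstar
      ≤ (f (x t) - f xstar) * max (1 / 2) (1 - α * c / (2 * L)) := by
  have hx := hrun.mem t
  have hv := hrun.vertex_mem t
  have hs := hrun.step_mem t
  have hvmin := isMinOn_iff.1 (hrun.vertex_isMinOn t)
  obtain ⟨γ, hγ, hnext⟩ := hrun.next_eq t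
  have hgap := hfconvex.inner_le hCconvex hx hxstar (hfdiff _ hx)
  have hlmo := hvmin xstar hxstar
  have hsc := hscaling (x t) hx (-RiemannianFW.riemGradient I f (x t)) (v t) hv
    (isMaxOn_iff.2 fun z hz => by simpa only [inner_neg_left, neg_le_neg_iff] using hvmin z hz)
  rw [norm_neg, inner_neg_left, RiemannianFW.norm_logMap hCconvex hx hv] at hsc
  have hupper := (abs_le.1 (hfsmooth (x t) hx (γ (s t)) (hγ.mapsTo hs))).2
  rw [hγ.logMap_apply hCconvex hCunique hx hv hs, real_inner_smul_right] at hupper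
  have hdist : dist (x t) (γ (s t)) ^ 2 ≤ (s t * dist (x t) (v t)) ^ 2 :=
    pow_le_pow_left₀ dist_nonneg (hγ.dist_le hCconvex hCunique hx hv hs) 2
  have hαc : α * c * dist (x t) (v t) ^ 2
      ≤ α * ‖RiemannianFW.riemGradient I f (x t)‖ * dist (x t) (v t) ^ 2 := by
    gcongr
    exact (hgrad _ hx).le
  refine RiemannianFW.shortStep_contraction hL (mul_pos hα hc).le
    (sub_nonneg.2 (isMinOn_iff.1 hmin _ hx)) (by linarith) (hαc.trans hsc) ?_
    (hrun.step_isMinOn t)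
  rw [hnext]
  have := mul_le_mul_of_nonneg_left hdist (by linarith : 0 ≤ L / 2)
  rw [mul_pow] at this
  linarith
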